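/- Let $\Omega\subset\mathbb R^n$ ($n\ge 1$) be a bounded Lipschitz domain and let $\varepsilon>0$. For $i=1,2,3$ let $\phi_i\in H^{1/2}(\partial\Omega)\cap L^\infty(\partial\Omega)$ with $\phi_i\ge 0$, where $H^{1/2}(\partial\Omega)$ is the space of traces of functions in $H^1(\Omega)$. Put $M:=\max_{i}\|\phi_i\|_{L^\infty(\partial\Omega)}$. Let $X:=(L^2(\Omega))^3$ with norm $\|u\|_X:=\max_{i}\|u_i\|_{L^2(\Omega)}$ and $$K:=\{u\in X:\ 0\le u_i\le M \text{ a.e. in }\Omega,\ i=1,2,3\}.$$ For $u\in K$ there is exactly one $v=(v_1,v_2,v_3)\in X$ such that, for every $i$ and with $\{i,j,\ell\}=\{1,2,3\}$, the function $v_i\in H^1(\Omega)$ has trace $\phi_i$ on $\partial\Omega$ and solves $-\Delta v_i+\frac{(u_ju_\ell)^2}{\varepsilon}v_i=0$ in $\Omega$ weakly, that is, $$\int_\Omega\nabla v_i\cdot\nabla\psi\,dx+\int_\Omega\frac{(u_ju_\ell)^2}{\varepsilon}\,v_i\,\psi\,dx=0\qquad\text{for all }\psi\in H^1_0(\Omega),$$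 where $H^1_0(\Omega)$ is the space of functions in $H^1(\Omega)$ with zero trace. The Picard map $T:K\to X$, $T(u):=v$, is continuous with respect to the norm of $X$. -/

import Mathlib

open MeasureTheory Set Filter Topology
open scoped ContDiff ENNReal NNReal

noncomputable section

namespace PartialSegregation

/-- Euclidean space `ℝⁿ`. -/
abbrev E (n : ℕ) : Type := EuclideanSpace ℝ (Fin n)

/-- A Lipschitz domain: an open connected (nonempty) set which, near every boundary point `x₀`, is
the strict epigraph of a Lipschitz function over a hyperplane. Here `e` is the unit normal of the
hyperplane, `x - ⟪e, x⟫ e` is the projection of `x` to the hyperplane and `⟪e, x⟫` is the height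
of `x` above it (only the values of `γ` on the hyperplane matter). -/
structure IsLipschitzDomain {n : ℕ} (Ω : Set (E n)) : Prop where
  isOpen : IsOpen Ω
  isConnected : IsConnected Ω
  locally_epigraph : ∀ x₀ ∈ frontier Ω, ∃ r : ℝ, 0 < r ∧ ∃ e : E n, ‖e‖ = 1 ∧
    ∃ (L : ℝ≥0) (γ : E n → ℝ), LipschitzWith L γ ∧
      ∀ x ∈ Metric.ball x₀ r, (x ∈ Ω ↔ γ (x - inner ℝ e x • e) < inner ℝ e x)

/-- Surface measure on `∂Ω`: the normalised `(n-1)`-dimensional Hausdorff measure on `∂Ω`. It is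
only used for `1 ≤ n`. -/
def surfaceMeasure {n : ℕ} (Ω : Set (E n)) : Measure (E n) :=
  (Measure.euclideanHausdorffMeasure (n - 1)).restrict (frontier Ω)

/-- `L²(Ω)`. -/
abbrev L2 {n : ℕ} (Ω : Set (E n)) : Type := Lp ℝ 2 (volume.restrict Ω)

/-- `L²(Ω; ℝⁿ)`, the space of square integrable vector fields. -/
abbrev L2Vec {n : ℕ} (Ω : Set (E n)) : Type := Lp (E n) 2 (volume.restrict Ω)

/-- `L²(∂Ω)`. -/
abbrev L2Bdry {n : ℕ} (Ω : Set (E n)) : Type := Lp ℝ 2 (surfaceMeasure Ω)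

/-- `g = ∇u` weakly in `Ω`: `∫_Ω u ∂ᵢη = - ∫_Ω gᵢ η` for all `η ∈ C_c^∞(Ω)` and all `i`. -/
def IsWeakGradient {n : ℕ} (Ω : Set (E n)) (u : L2 Ω) (g : L2Vec Ω) : Prop :=
  ∀ η : E n → ℝ, ContDiff ℝ ∞ η → HasCompactSupport η → tsupport η ⊆ Ω →
    ∀ i : Fin n, ∫ x in Ω, u x * fderiv ℝ η x (EuclideanSpace.single i 1)
      = - ∫ x in Ω, g x i * η x

/-- The Sobolev space `H¹(Ω)`. -/
def H1 {n : ℕ} (Ω : Set (E n)) : Set (L2 Ω) :=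
  {u | ∃ g : L2Vec Ω, IsWeakGradient Ω u g}

/-- `u ∈ H¹(Ω)` has trace `φ ∈ L²(∂Ω)`. The trace operator is the continuous extension of the
restriction to `∂Ω` of functions that are smooth up to the boundary, so `u` has trace `φ` when there
are smooth `f k` with `f k → u` in `H¹(Ω)` and `f k → φ` in `L²(∂Ω)`. -/
def HasTrace {n : ℕ} (Ω : Set (E n)) (u : L2 Ω) (φ : L2Bdry Ω) : Prop :=
  ∃ g : L2Vec Ω, IsWeakGradient Ω u g ∧
    ∃ f : ℕ → E n → ℝ, (∀ k, ContDiff ℝ ∞ (f k)) ∧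
      Tendsto (fun k => eLpNorm (fun x => f k x - u x) 2 (volume.restrict Ω)) atTop (𝓝 0) ∧
      Tendsto (fun k => eLpNorm (fun x => gradient (f k) x - g x) 2 (volume.restrict Ω))
        atTop (𝓝 0) ∧
      Tendsto (fun k => eLpNorm (fun x => f k x - φ x) 2 (surfaceMeasure Ω)) atTop (𝓝 0)

/-- The space `H¹₀(Ω)` of functions in `H¹(Ω)` with zero trace. -/
def H10 {n : ℕ} (Ω : Set (E n)) : Set (L2 Ω) := {w | w ∈ H1 Ω ∧ HasTrace Ω w 0}

/-- The trace space `H^{1/2}(∂Ω)`: the range of the trace operator on `H¹(Ω)`. -/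
def HHalf {n : ℕ} (Ω : Set (E n)) : Set (L2Bdry Ω) := {φ | ∃ u ∈ H1 Ω, HasTrace Ω u φ}

/-- `z ∈ H¹(Ω)` is a weak solution of `-Δz + c z = 0` in `Ω`, tested with `H¹₀(Ω)`. -/
def IsWeakSolution {n : ℕ} (Ω : Set (E n)) (c : E n → ℝ) (z : L2 Ω) : Prop :=
  ∃ g : L2Vec Ω, IsWeakGradient Ω z g ∧
    ∀ ψ ∈ H10 Ω, ∀ h : L2Vec Ω, IsWeakGradient Ω ψ h →
      (∫ x in Ω, inner ℝ (g x) (h x)) + ∫ x in Ω, c x * z x * ψ x = 0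

/-- The Banach space `X = (L²(Ω))³`; its norm is the maximum of the `L²` norms of the components. -/
abbrev X {n : ℕ} (Ω : Set (E n)) : Type := Fin 3 → L2 Ω

/-- `M = maxᵢ ‖φᵢ‖_{L^∞(∂Ω)}`. -/
def supBound {n : ℕ} (Ω : Set (E n)) (φ : Fin 3 → L2Bdry Ω) : ℝ :=
  ⨆ i : Fin 3, (eLpNorm (φ i) ⊤ (surfaceMeasure Ω)).toReal

/-- `K = {u ∈ X : 0 ≤ uᵢ ≤ M a.e. in Ω, i = 1, 2, 3}`. -/
def K {n : ℕ} (Ω : Set (E n)) (φ : Fin 3 → L2Bdry Ω) : Set (X Ω) :=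
  {u | ∀ i, ∀ᵐ x ∂(volume.restrict Ω), 0 ≤ u i x ∧ u i x ≤ supBound Ω φ}

/-- The relation `v = T(u)`: for every `i`, with `{i, j, l} = {1, 2, 3}`, the function `vᵢ` is a
weak solution of `-Δvᵢ + ((uⱼ uₗ)² / ε) vᵢ = 0` in `Ω` with trace `φᵢ` on `∂Ω`. The indices live in
`Fin 3`, where addition is modulo 3, so that `j = i + 1` and `l = i + 2`. -/
def IsPicardImage {n : ℕ} (Ω : Set (E n)) (ε : ℝ) (φ : Fin 3 → L2Bdry Ω) (u v : X Ω) : Prop :=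
  ∀ i : Fin 3,
    IsWeakSolution Ω (fun x => (u (i + 1) x * u (i + 2) x) ^ 2 / ε) (v i) ∧
      HasTrace Ω (v i) (φ i)

open Classical in
/-- The Picard map `T : K → X` (with value `0` at points where the boundary value problem
has no solution; the theorem asserts that this never happens). -/
def picardMap {n : ℕ} (Ω : Set (E n)) (ε : ℝ) (φ : Fin 3 → L2Bdry Ω) (u : K Ω φ) : X Ω :=
  if h : ∃ v : X Ω, IsPicardImage Ω ε φ u v then h.choose else 0

end PartialSegregation

end

namespace PartialSegregation

/-! ### A Poincaré inequality with boundary term -/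

/-! Each equation is a linear Dirichlet problem `-Δz + c z = 0` with a nonnegative bounded potential
`c`, and `u` enters only through `c`. Everything rests on one constant `C` in Poincaré's inequality
`‖w‖ ≤ C ‖∇w‖` for zero trace (`exists_norm_le_gradient`); it depends on `Ω`, not on `u`. Existence
is Lax–Milgram on the closed graph of pairs `(w, ∇w)` with zero trace, after subtracting an
extension of the boundary datum (`exists_solvesWith`). For two solutions with the same trace,
testing the difference of the equations with `w = v₁ - v₂` and dropping the nonnegative term `∫ c₁
w²` gives `‖v₁ - v₂‖ ≤ C² ‖(c₁ - c₂) v₂‖` (`norm_sub_le_of_solvesWith`). With `c₁ = c₂` this is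
uniqueness. With `v₂` fixed and `c₁` running along a sequence it is continuity: on `K` the
potentials are uniformly bounded and converge a.e. along a subsequence, so dominated convergence
applies (`tendsto_mul_of_ae_tendsto`). Since traces are defined by smooth approximation, Poincaré's
inequality is proved for smooth functions with a boundary term and passed to the limit. From each
point of `Ω` one descends vertically to the first point outside `Ω`, which lies on `∂Ω`, and
integrates the derivative along that segment. -/

/-- The point of `ℝ^{m+1}` with first coordinate `t` and remaining coordinates `y`. -/
def consPoint {m : ℕ} (t : ℝ) (y : Fin m → ℝ) : E (m + 1) := WithLp.toLp 2 (Fin.cons t y)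

lemma measurePreserving_consPoint (m : ℕ) :
    MeasurePreserving (fun p : ℝ × (Fin m → ℝ) => consPoint p.1 p.2) := by
  have h1 := (volume_preserving_piFinSuccAbove (fun _ : Fin (m + 1) => ℝ) 0).symm
  have h2 := (PiLp.volume_preserving_toLp (Fin (m + 1))).comp h1
  convert! h2 using 1
  funext p
  simp [consPoint, MeasurableEquiv.piFinSuccAbove, Fin.insertNthEquiv]

lemma continuous_consPoint (m : ℕ) :
    Continuous (fun p : ℝ × (Fin m → ℝ) => consPoint p.1 p.2) := by
  unfold consPoint
  refine (PiLp.continuous_toLp 2 _).comp (continuous_pi fun i => ?_)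
  refine Fin.cases ?_ (fun j => ?_) i
  · simpa using continuous_fst
  · simpa using (by fun_prop : Continuous fun a : ℝ × (Fin m → ℝ) => a.2 j)

lemma hasDerivAt_consPoint {m : ℕ} (y : Fin m → ℝ) (t : ℝ) :
    HasDerivAt (fun s => consPoint s y) (EuclideanSpace.single 0 1) t := by
  have h : (fun s : ℝ => consPoint s y) =
      fun s => s • (EuclideanSpace.single 0 1 : E (m + 1)) + consPoint 0 y := by
    funext s
    ext i
    refine Fin.cases ?_ (fun j => ?_) i <;> simp [consPoint]
  rw [h]
  simpa using ((hasDerivAt_id t).smul_const (EuclideanSpace.single 0 1 : E (m + 1))).add_const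
    (consPoint 0 y)

lemma abs_le_norm_consPoint {m : ℕ} (y : Fin m → ℝ) (t : ℝ) : |t| ≤ ‖consPoint t y‖ := by
  have := PiLp.norm_apply_le (consPoint t y) 0
  simpa [consPoint] using this

/-- The height of the highest point below `(t, y)` on the vertical line over `y` that is not in
`Ω`. -/
noncomputable def exitHeight {m : ℕ} (Ω : Set (E (m + 1))) (t : ℝ) (y : Fin m → ℝ) : ℝ :=
  sSup {s | s ≤ t ∧ consPoint s y ∉ Ω}

section ExitHeight

variable {m : ℕ} {Ω : Set (E (m + 1))} {R : ℝ}

lemma exitHeight_spec (hΩ : IsOpen Ω) (hR : ∀ x ∈ Ω, ‖x‖ < R) (t : ℝ) (y : Fin m → ℝ) :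
    exitHeight Ω t y ≤ t ∧ consPoint (exitHeight Ω t y) y ∉ Ω := by
  have hcl : IsClosed {s | s ≤ t ∧ consPoint s y ∉ Ω} := by
    refine isClosed_Iic.inter ?_
    exact hΩ.isClosed_compl.preimage
      ((continuous_consPoint m).comp (continuous_id.prodMk continuous_const))
  -- Boundedness makes the set nonempty: a point of height at most `-R` has norm at least `R`.
  refine hcl.csSup_mem ⟨min t (-R), min_le_left _ _, fun h => ?_⟩ ⟨t, fun s hs => hs.1⟩
  have h1 := hR _ h
  have h2 := abs_le_norm_consPoint y (min t (-R))
  have h3 := neg_abs_le (min t (-R))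
  have h4 := min_le_right t (-R)
  linarith

lemma mem_of_exitHeight_lt {t s : ℝ} {y : Fin m → ℝ} (h1 : exitHeight Ω t y < s)
    (h2 : s ≤ t) : consPoint s y ∈ Ω := by
  by_contra h
  exact absurd (le_csSup (s := {s | s ≤ t ∧ consPoint s y ∉ Ω}) ⟨t, fun s hs => hs.1⟩ ⟨h2, h⟩)
    (not_le.2 h1)

lemma exitHeight_lt (hΩ : IsOpen Ω) (hR : ∀ x ∈ Ω, ‖x‖ < R) {t : ℝ} {y : Fin m → ℝ}
    (h : consPoint t y ∈ Ω) : exitHeight Ω t y < t := by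
  have hs := exitHeight_spec hΩ hR t y
  refine lt_of_le_of_ne hs.1 fun h' => hs.2 ?_
  rwa [h']

lemma exitPoint_mem_frontier (hΩ : IsOpen Ω) (hR : ∀ x ∈ Ω, ‖x‖ < R) {t : ℝ} {y : Fin m → ℝ}
    (h : consPoint t y ∈ Ω) : consPoint (exitHeight Ω t y) y ∈ frontier Ω := by
  rw [hΩ.frontier_eq]
  refine ⟨?_, (exitHeight_spec hΩ hR t y).2⟩
  have hlt := exitHeight_lt hΩ hR h
  have hc : ContinuousWithinAt (fun s => consPoint s y) (Ioc (exitHeight Ω t y) t)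
      (exitHeight Ω t y) :=
    ((continuous_consPoint m).comp (continuous_id.prodMk continuous_const)).continuousWithinAt
  refine closure_mono ?_ (hc.mem_closure_image ?_)
  · rintro _ ⟨s, hs, rfl⟩
    exact mem_of_exitHeight_lt hs.1 hs.2
  · rw [closure_Ioc hlt.ne]
    exact ⟨le_rfl, hlt.le⟩

/-- For `a ≤ t` the exit height is below `a` exactly when the whole segment over `y` between heights
`a` and `t` lies in `Ω`. By compactness of the segment this is an open condition on `y`. -/
lemma measurable_exitHeight (hΩ : IsOpen Ω) (hR : ∀ x ∈ Ω, ‖x‖ < R) (t : ℝ) :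
    Measurable (exitHeight Ω t) := by
  refine measurable_of_Iio fun a => ?_
  rcases lt_or_ge t a with hta | hat
  · convert! MeasurableSet.univ
    ext y
    simpa using (exitHeight_spec hΩ hR t y).1.trans_lt hta
  · have hset : exitHeight Ω t ⁻¹' Iio a = {y | ∀ s ∈ Icc a t, consPoint s y ∈ Ω} := by
      ext y
      refine ⟨fun h s hs => mem_of_exitHeight_lt (lt_of_lt_of_le h hs.1) hs.2, fun h => ?_⟩
      by_contra h'
      have hs := exitHeight_spec hΩ hR t y
      exact hs.2 (h _ ⟨not_lt.1 h', hs.1⟩)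
    rw [hset]
    refine IsOpen.measurableSet (isOpen_iff_eventually.2 fun y hy => ?_)
    refine isCompact_Icc.eventually_forall_of_forall_eventually fun s hs => ?_
    exact ((continuous_consPoint m).comp continuous_swap).continuousAt.eventually_mem
      (hΩ.mem_nhds (hy s hs))

/-- Forgetting the first coordinate is 1-Lipschitz and undoes `y ↦` exit point. It cannot increase
Hausdorff measure, so a set of base points has volume at most the surface measure of its exit
points. -/
lemma map_exitPoint_le (hΩ : IsOpen Ω) (hR : ∀ x ∈ Ω, ‖x‖ < R) (t : ℝ) :
    Measure.map (fun y => consPoint (exitHeight Ω t y) y)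
      (volume.restrict {y : Fin m → ℝ | consPoint t y ∈ Ω}) ≤ surfaceMeasure Ω := by
  have hmeas : Measurable fun y => consPoint (exitHeight Ω t y) y :=
    (continuous_consPoint m).measurable.comp
      ((measurable_exitHeight hΩ hR t).prodMk measurable_id)
  refine Measure.le_iff.2 fun B hB => ?_
  rw [Measure.map_apply hmeas hB, Measure.restrict_apply (hmeas hB), surfaceMeasure,
    Measure.restrict_apply hB]
  let q : E (m + 1) → E m := fun x => WithLp.toLp 2 (fun i => x i.succ)
  have hq : LipschitzWith 1 q := by
    refine LipschitzWith.of_dist_le_mul fun x z => ?_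
    rw [EuclideanSpace.dist_eq, EuclideanSpace.dist_eq, NNReal.coe_one, one_mul]
    refine Real.sqrt_le_sqrt ?_
    rw [Fin.sum_univ_succ]
    exact le_add_of_nonneg_left (sq_nonneg _)
  set A := (fun y => consPoint (exitHeight Ω t y) y) ⁻¹' B ∩ {y : Fin m → ℝ | consPoint t y ∈ Ω}
  have hA : (volume A) = volume ((MeasurableEquiv.toLp 2 (Fin m → ℝ)).symm ⁻¹' A) :=
    ((EuclideanSpace.volume_preserving_symm_measurableEquiv_toLp (Fin m)).measure_preimage_equiv
      A).symm
  have hsub : (MeasurableEquiv.toLp 2 (Fin m → ℝ)).symm ⁻¹' A ⊆ q '' (B ∩ frontier Ω) := by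
    intro z hz
    refine ⟨_, ⟨hz.1, exitPoint_mem_frontier hΩ hR hz.2⟩, ?_⟩
    ext i
    simp [q, consPoint]
  rw [hA, ← EuclideanSpace.euclideanHausdorffMeasure_eq_volume]
  refine (measure_mono hsub).trans ?_
  simp only [Nat.add_sub_cancel, Measure.euclideanHausdorffMeasure_def, Measure.smul_apply]
  gcongr
  simpa using (hq.lipschitzOnWith (s := B ∩ frontier Ω)).hausdorffMeasure_image_le
    (d := (m : ℝ)) (Nat.cast_nonneg m)

/-- Fundamental theorem of calculus from the exit point up to `(t, y)`, Cauchy–Schwarz on a segment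
of length at most `2R`, and `(a + b)² ≤ 2(a² + b²)`; hence the factor `4R`. -/
lemma enorm_sq_le_exitPoint (hΩ : IsOpen Ω) (hR : ∀ x ∈ Ω, ‖x‖ < R) {f : E (m + 1) → ℝ}
    (hf : ContDiff ℝ ∞ f) {t : ℝ} {y : Fin m → ℝ} (h : consPoint t y ∈ Ω) :
    ‖f (consPoint t y)‖ₑ ^ 2 ≤ 2 * ‖f (consPoint (exitHeight Ω t y) y)‖ₑ ^ 2 +
      4 * ENNReal.ofReal R * ∫⁻ s, Ω.indicator (fun x => ‖gradient f x‖ₑ ^ 2) (consPoint s y) := by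
  set s₀ := exitHeight Ω t y
  have hlt : s₀ < t := exitHeight_lt hΩ hR h
  have hI : ∀ s ∈ Ioc s₀ t, consPoint s y ∈ Ω := fun s hs => mem_of_exitHeight_lt hs.1 hs.2
  have hcont : Continuous fun s => consPoint s y :=
    (continuous_consPoint m).comp (continuous_id.prodMk continuous_const)
  have hgrad : Continuous (gradient f) :=
    (InnerProductSpace.toDual ℝ (E (m + 1))).symm.continuous.comp (hf.continuous_fderiv (by simp))
  have hder : ∀ s, HasDerivAt (fun s => f (consPoint s y))
      (fderiv ℝ f (consPoint s y) (EuclideanSpace.single 0 1)) s := fun s =>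
    ((hf.differentiable (by simp)) _).hasFDerivAt.comp_hasDerivAt s (hasDerivAt_consPoint y s)
  have hdc : Continuous fun s => fderiv ℝ f (consPoint s y) (EuclideanSpace.single 0 1) :=
    ((hf.continuous_fderiv (by simp)).comp hcont).clm_apply continuous_const
  have hftc := intervalIntegral.integral_eq_sub_of_hasDerivAt (a := s₀) (b := t)
    (fun s _ => hder s) (hdc.intervalIntegrable _ _)
  rw [intervalIntegral.integral_of_le hlt.le] at hftc
  have hbound : ∀ s, ‖fderiv ℝ f (consPoint s y) (EuclideanSpace.single 0 1)‖ₑ ≤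
      ‖gradient f (consPoint s y)‖ₑ := by
    intro s
    rw [← ofReal_norm, ← ofReal_norm]
    refine ENNReal.ofReal_le_ofReal ?_
    refine ((fderiv ℝ f (consPoint s y)).le_opNorm _).trans ?_
    simp [gradient]
  have hlen : volume (Ioc s₀ t) ≤ 2 * ENNReal.ofReal R := by
    rw [Real.volume_Ioc, two_mul, ← ENNReal.ofReal_add]
    · refine ENNReal.ofReal_le_ofReal ?_
      have h1 := (abs_le_norm_consPoint y t).trans (hR _ h).le
      have h2 : -R ≤ s₀ := by
        have hs : ∀ s ∈ Ioc s₀ t, -R ≤ s := fun s hs => by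
          have := (abs_le_norm_consPoint y s).trans (hR _ (hI s hs)).le
          exact (abs_le.1 this).1
        refine le_of_forall_gt_imp_ge_of_dense fun a ha => ?_
        exact (hs (min a t) ⟨lt_min ha hlt, min_le_right _ _⟩).trans (min_le_left _ _)
      linarith [(abs_le.1 h1).2]
    all_goals exact (norm_nonneg _).trans (hR _ h).le
  have hCS : (∫⁻ s in Ioc s₀ t, ‖gradient f (consPoint s y)‖ₑ) ^ 2 ≤
      2 * ENNReal.ofReal R *
        ∫⁻ s, Ω.indicator (fun x => ‖gradient f x‖ₑ ^ 2) (consPoint s y) := by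
    have h1 := eLpNorm_le_eLpNorm_mul_rpow_measure_univ (μ := volume.restrict (Ioc s₀ t))
      (p := 1) (q := 2) (by norm_num)
      (hgrad.comp hcont).aestronglyMeasurable
    rw [eLpNorm_one_eq_lintegral_enorm, Measure.restrict_apply_univ] at h1
    have h2 := pow_le_pow_left' h1 2
    refine h2.trans ?_
    have h3 : (volume (Ioc s₀ t) ^ (1 / (1 : ℝ≥0∞).toReal - 1 / (2 : ℝ≥0∞).toReal)) ^ 2 =
        volume (Ioc s₀ t) := by
      rw [← ENNReal.rpow_natCast, ← ENNReal.rpow_mul]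
      norm_num
    have h4 : eLpNorm (gradient f ∘ fun s => consPoint s y) 2 (volume.restrict (Ioc s₀ t)) ^ 2 =
        ∫⁻ s in Ioc s₀ t, ‖gradient f (consPoint s y)‖ₑ ^ 2 := by
      simpa using eLpNorm_nnreal_pow_eq_lintegral (p := 2) (by simp)
        (f := gradient f ∘ fun s => consPoint s y) (μ := volume.restrict (Ioc s₀ t))
    rw [mul_pow, h3, h4, mul_comm]
    refine mul_le_mul' hlen ?_
    rw [← lintegral_indicator measurableSet_Ioc]
    refine lintegral_mono fun s => ?_
    by_cases hs : s ∈ Ioc s₀ t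
    · simp [hs, hI s hs]
    · simp [hs]
  have hmain : ‖f (consPoint t y)‖ₑ ≤ ‖f (consPoint s₀ y)‖ₑ +
      ∫⁻ s in Ioc s₀ t, ‖gradient f (consPoint s y)‖ₑ := by
    have : f (consPoint t y) = f (consPoint s₀ y) +
        ∫ s in Ioc s₀ t, fderiv ℝ f (consPoint s y) (EuclideanSpace.single 0 1) := by
      rw [hftc]; ring
    rw [this]
    refine (enorm_add_le _ _).trans (add_le_add le_rfl ?_)
    exact (enorm_integral_le_lintegral_enorm _).trans (lintegral_mono hbound)
  calc ‖f (consPoint t y)‖ₑ ^ 2 ≤ (‖f (consPoint s₀ y)‖ₑ +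
      ∫⁻ s in Ioc s₀ t, ‖gradient f (consPoint s y)‖ₑ) ^ 2 := pow_le_pow_left' hmain 2
    _ ≤ 2 * (‖f (consPoint s₀ y)‖ₑ ^ 2 +
        (∫⁻ s in Ioc s₀ t, ‖gradient f (consPoint s y)‖ₑ) ^ 2) := by
      have := ENNReal.rpow_add_le_mul_rpow_add_rpow (‖f (consPoint s₀ y)‖ₑ)
        (∫⁻ s in Ioc s₀ t, ‖gradient f (consPoint s y)‖ₑ) (p := 2) (by norm_num)
      norm_num at this
      exact_mod_cast this
    _ ≤ _ := by
      rw [mul_add]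
      refine add_le_add le_rfl ((mul_le_mul' le_rfl hCS).trans (le_of_eq ?_))
      ring

/-- Poincaré's inequality with a boundary term for smooth functions on a bounded open set. -/
lemma lintegral_sq_le_boundary_add_gradient (hΩ : IsOpen Ω) (hR : ∀ x ∈ Ω, ‖x‖ < R)
    {f : E (m + 1) → ℝ} (hf : ContDiff ℝ ∞ f) :
    ∫⁻ x in Ω, ‖f x‖ₑ ^ 2 ≤ 2 * ENNReal.ofReal R * (2 * ∫⁻ x, ‖f x‖ₑ ^ 2 ∂surfaceMeasure Ω +
      4 * ENNReal.ofReal R * ∫⁻ x in Ω, ‖gradient f x‖ₑ ^ 2) := by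
  have hgrad : Continuous (gradient f) :=
    (InnerProductSpace.toDual ℝ (E (m + 1))).symm.continuous.comp (hf.continuous_fderiv (by simp))
  have hfm : Measurable fun x => ‖f x‖ₑ ^ 2 := (hf.continuous.measurable.enorm).pow_const 2
  have hgm : Measurable fun x => ‖gradient f x‖ₑ ^ 2 := (hgrad.measurable.enorm).pow_const 2
  have hcm : Measurable (fun p : ℝ × (Fin m → ℝ) => consPoint p.1 p.2) :=
    (continuous_consPoint m).measurable
  have hprod : ∀ F : E (m + 1) → ℝ≥0∞, Measurable F →
      ∫⁻ x in Ω, F x = ∫⁻ t, ∫⁻ y, Ω.indicator F (consPoint t y) := by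
    intro F hF
    have hFi := hF.indicator hΩ.measurableSet
    rw [← lintegral_indicator hΩ.measurableSet,
      ← (measurePreserving_consPoint m).lintegral_comp hFi]
    exact lintegral_prod _ (hFi.comp hcm).aemeasurable
  set G := ∫⁻ x in Ω, ‖gradient f x‖ₑ ^ 2
  set S := ∫⁻ x, ‖f x‖ₑ ^ 2 ∂surfaceMeasure Ω
  have hG : ∫⁻ y, ∫⁻ s, Ω.indicator (fun x => ‖gradient f x‖ₑ ^ 2) (consPoint s y) = G := by
    rw [lintegral_lintegral_swap]
    · exact (hprod _ hgm).symm
    · exact (((hgm.indicator hΩ.measurableSet).comp hcm).comp measurable_swap).aemeasurable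
  -- The bound on a slice does not depend on its height, and slices with `|t| > R` are empty;
  -- integrating over `t` yields the outer factor `2R`.
  have hslice : ∀ t : ℝ, ∫⁻ y, Ω.indicator (fun x => ‖f x‖ₑ ^ 2) (consPoint t y) ≤
      (Icc (-R) R).indicator (fun _ => 2 * S + 4 * ENNReal.ofReal R * G) t := by
    intro t
    by_cases ht : t ∈ Icc (-R) R
    · rw [indicator_of_mem ht]
      have hct : Continuous fun y : Fin m → ℝ => consPoint t y :=
        (continuous_consPoint m).comp (continuous_const.prodMk continuous_id)
      have hD : MeasurableSet {y : Fin m → ℝ | consPoint t y ∈ Ω} :=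
        (hΩ.preimage hct).measurableSet
      have hpm : Measurable fun y => consPoint (exitHeight Ω t y) y :=
        hcm.comp ((measurable_exitHeight hΩ hR t).prodMk measurable_id)
      calc ∫⁻ y, Ω.indicator (fun x => ‖f x‖ₑ ^ 2) (consPoint t y)
          = ∫⁻ y in {y : Fin m → ℝ | consPoint t y ∈ Ω}, ‖f (consPoint t y)‖ₑ ^ 2 := by
            rw [← lintegral_indicator hD]
            rfl
        _ ≤ ∫⁻ y in {y : Fin m → ℝ | consPoint t y ∈ Ω},
              (2 * ‖f (consPoint (exitHeight Ω t y) y)‖ₑ ^ 2 + 4 * ENNReal.ofReal R *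
              ∫⁻ s, Ω.indicator (fun x => ‖gradient f x‖ₑ ^ 2) (consPoint s y)) :=
            setLIntegral_mono' hD fun y hy => enorm_sq_le_exitPoint hΩ hR hf hy
        _ ≤ 2 * S + 4 * ENNReal.ofReal R * G := by
            have hfp : Measurable fun y : Fin m → ℝ =>
                ‖f (consPoint (exitHeight Ω t y) y)‖ₑ ^ 2 := hfm.comp hpm
            rw [lintegral_add_left (hfp.const_mul 2),
              lintegral_const_mul _ hfp, lintegral_const_mul']
            · refine add_le_add (mul_le_mul' le_rfl ?_) (mul_le_mul' le_rfl ?_)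
              · rw [← lintegral_map (f := fun x => ‖f x‖ₑ ^ 2) hfm hpm]
                exact lintegral_mono' (map_exitPoint_le hΩ hR t) le_rfl
              · rw [← hG]
                exact setLIntegral_le_lintegral _ _
            · finiteness
    · have h0 : ∀ y : Fin m → ℝ, Ω.indicator (fun x => ‖f x‖ₑ ^ 2) (consPoint t y) = 0 := by
        intro y
        refine indicator_of_notMem (fun h => ht ?_) _
        exact abs_le.1 ((abs_le_norm_consPoint y t).trans (hR _ h).le)
      simp [h0]
  rw [hprod _ hfm]
  refine (lintegral_mono hslice).trans (le_of_eq ?_)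
  rw [lintegral_indicator measurableSet_Icc, setLIntegral_const, Real.volume_Icc,
    mul_comm, sub_neg_eq_add, ← two_mul, ENNReal.ofReal_mul zero_le_two]
  simp

end ExitHeight

/-! ### Weak gradients -/

section WeakGradient

variable {n : ℕ} {Ω : Set (E n)}

/-- Both sides of the defining identity are `L²` inner products with a fixed function. Linearity and
closedness of the weak gradient relation follow from this. -/
lemma exists_weakGradient_functionals (Ω : Set (E n)) {η : E n → ℝ} (hη : ContDiff ℝ ∞ η)
    (hs : HasCompactSupport η) (i : Fin n) :
    ∃ (A : L2 Ω →L[ℝ] ℝ) (B : L2Vec Ω →L[ℝ] ℝ),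
      (∀ u, A u = ∫ x in Ω, u x * fderiv ℝ η x (EuclideanSpace.single i 1)) ∧
      (∀ g, B g = ∫ x in Ω, g x i * η x) := by
  have h1 : MemLp (fun x => fderiv ℝ η x (EuclideanSpace.single i 1)) 2
      (volume.restrict Ω) := by
    refine Continuous.memLp_of_hasCompactSupport ?_ ?_
    · exact (hη.continuous_fderiv (by simp)).clm_apply continuous_const
    · exact (hs.fderiv ℝ).comp_left (g := fun L : E n →L[ℝ] ℝ => L (EuclideanSpace.single i 1))
        (by simp)
  have h2 : MemLp (fun x => η x • (EuclideanSpace.single i 1 : E n)) 2 (volume.restrict Ω) :=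
    Continuous.memLp_of_hasCompactSupport (hη.continuous.smul continuous_const) hs.smul_right
  refine ⟨innerSL ℝ (h1.toLp _), innerSL ℝ (h2.toLp _), fun u => ?_, fun g => ?_⟩
  · rw [innerSL_apply_apply, L2.inner_def]
    refine integral_congr_ae ?_
    filter_upwards [h1.coeFn_toLp] with x hx
    simp [hx]
  · rw [innerSL_apply_apply, L2.inner_def]
    refine integral_congr_ae ?_
    filter_upwards [h2.coeFn_toLp] with x hx
    simp [hx, inner_smul_left, EuclideanSpace.inner_single_left, mul_comm]

lemma IsWeakGradient.add_smul {u u' : L2 Ω} {g g' : L2Vec Ω} (h : IsWeakGradient Ω u g)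
    (h' : IsWeakGradient Ω u' g') (a : ℝ) :
    IsWeakGradient Ω (u + a • u') (g + a • g') := by
  intro η hη hs hΩ i
  obtain ⟨A, B, hA, hB⟩ := exists_weakGradient_functionals Ω hη hs i
  have h1 := h η hη hs hΩ i
  have h2 := h' η hη hs hΩ i
  rw [← hA, ← hB] at h1 h2 ⊢
  rw [map_add, map_add, map_smul, map_smul, h1, h2]
  simp only [smul_eq_mul]
  ring

lemma isClosed_setOf_isWeakGradient (Ω : Set (E n)) :
    IsClosed {p : WithLp 2 (L2 Ω × L2Vec Ω) | IsWeakGradient Ω p.fst p.snd} := by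
  simp only [IsWeakGradient, ofPred_forall]
  refine isClosed_iInter fun η => isClosed_iInter fun hη => isClosed_iInter fun hs =>
    isClosed_iInter fun _ => isClosed_iInter fun i => ?_
  obtain ⟨A, B, hA, hB⟩ := exists_weakGradient_functionals Ω hη hs i
  simp only [← hA, ← hB]
  exact isClosed_eq (by fun_prop) (by fun_prop)

/-- The fundamental lemma of the calculus of variations, applied to each component of `g - h`. It
identifies the gradients supplied by separate existential statements. -/
lemma IsWeakGradient.unique (hΩ : IsOpen Ω) {u : L2 Ω} {g h : L2Vec Ω}
    (hg : IsWeakGradient Ω u g) (hh : IsWeakGradient Ω u h) : g = h := by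
  rw [← sub_eq_zero]
  set d := g - h
  have hd : ∀ i : Fin n, ∀ᵐ x ∂(volume.restrict Ω), d x i = 0 := by
    intro i
    rw [ae_restrict_iff' hΩ.measurableSet]
    refine hΩ.ae_eq_zero_of_integral_contDiff_smul_eq_zero ?_ fun η hη hs hsub => ?_
    · refine locallyIntegrableOn_of_locallyIntegrable_restrict ?_
      have : MemLp (fun x => d x i) 2 (volume.restrict Ω) :=
        (EuclideanSpace.proj (𝕜 := ℝ) i : E n →L[ℝ] ℝ).comp_memLp' (Lp.memLp d)
      exact this.locallyIntegrable (by norm_num)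
    · obtain ⟨A, B, hA, hB⟩ := exists_weakGradient_functionals Ω hη hs i
      have h1 := hg η hη hs hsub i
      have h2 := hh η hη hs hsub i
      rw [← hA, ← hB] at h1 h2
      have h3 : ∫ x in Ω, d x i * η x = 0 := by
        rw [← hB, map_sub]
        linarith
      rw [← h3, setIntegral_eq_integral_of_forall_compl_eq_zero]
      · simp [mul_comm]
      · intro x hx
        rw [image_eq_zero_of_notMem_tsupport fun h => hx (hsub h), mul_zero]
  refine (Lp.eq_zero_iff_ae_eq_zero).2 ?_
  filter_upwards [ae_all_iff.2 hd] with x hx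
  ext i
  simpa using hx i

end WeakGradient

/-! ### Traces -/

section Trace

variable {n : ℕ} {Ω : Set (E n)}

lemma continuous_gradient {f : E n → ℝ} (hf : ContDiff ℝ ∞ f) : Continuous (gradient f) :=
  (InnerProductSpace.toDual ℝ (E n)).symm.continuous.comp (hf.continuous_fderiv (by simp))

/-- `u` has weak gradient `g` and trace `φ`, the pair `(u, g)` and `φ` being approximated by the
same smooth functions. -/
def HasTraceWith (Ω : Set (E n)) (u : L2 Ω) (g : L2Vec Ω) (φ : L2Bdry Ω) : Prop :=
  IsWeakGradient Ω u g ∧ ∀ δ : ℝ≥0∞, 0 < δ → ∃ f : E n → ℝ, ContDiff ℝ ∞ f ∧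
    eLpNorm (fun x => f x - u x) 2 (volume.restrict Ω) ≤ δ ∧
    eLpNorm (fun x => gradient f x - g x) 2 (volume.restrict Ω) ≤ δ ∧
    eLpNorm (fun x => f x - φ x) 2 (surfaceMeasure Ω) ≤ δ

/-- Names the gradient and trades the approximating sequence for one smooth function per tolerance,
the form suited to sums and limits. -/
lemma hasTrace_iff {u : L2 Ω} {φ : L2Bdry Ω} :
    HasTrace Ω u φ ↔ ∃ g, HasTraceWith Ω u g φ := by
  refine ⟨fun ⟨g, hg, f, hf, h1, h2, h3⟩ => ⟨g, hg, fun δ hδ => ?_⟩, fun ⟨g, hg, h⟩ => ?_⟩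
  · obtain ⟨k, hk⟩ := ((h1.eventually_le_const hδ).and
      ((h2.eventually_le_const hδ).and (h3.eventually_le_const hδ))).exists
    exact ⟨f k, hf k, hk⟩
  · have hpos : ∀ k : ℕ, (0 : ℝ≥0∞) < ((k : ℝ≥0∞) + 1)⁻¹ := fun k =>
      ENNReal.inv_pos.2 (by finiteness)
    have hlim : Tendsto (fun k : ℕ => ((k : ℝ≥0∞) + 1)⁻¹) atTop (𝓝 0) := by
      have := (tendsto_add_atTop_iff_nat 1).2 ENNReal.tendsto_inv_nat_nhds_zero
      simpa using this
    choose f hf h1 h2 h3 using fun k => h _ (hpos k)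
    refine ⟨g, hg, f, hf, ?_, ?_, ?_⟩
    · exact tendsto_of_tendsto_of_tendsto_of_le_of_le tendsto_const_nhds hlim (fun _ => zero_le) h1
    · exact tendsto_of_tendsto_of_tendsto_of_le_of_le tendsto_const_nhds hlim (fun _ => zero_le) h2
    · exact tendsto_of_tendsto_of_tendsto_of_le_of_le tendsto_const_nhds hlim (fun _ => zero_le) h3

lemma eLpNorm_add_smul_sub_le {α F : Type*} [MeasurableSpace α] [NormedAddCommGroup F]
    [NormedSpace ℝ F] {ν : Measure α} {f f' : α → F} (hf : AEStronglyMeasurable f ν)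
    (hf' : AEStronglyMeasurable f' ν) (u u' : Lp F 2 ν) (a : ℝ) {δ : ℝ≥0∞}
    (h : eLpNorm (fun x => f x - u x) 2 ν ≤ δ) (h' : eLpNorm (fun x => f' x - u' x) 2 ν ≤ δ) :
    eLpNorm (fun x => (f x + a • f' x) - (u + a • u' : Lp F 2 ν) x) 2 ν ≤ δ * (1 + ‖a‖ₑ) := by
  have heq : (fun x => (f x + a • f' x) - (u + a • u' : Lp F 2 ν) x) =ᵐ[ν]
      (fun x => f x - u x) + a • (fun x => f' x - u' x) := by
    filter_upwards [Lp.coeFn_add u (a • u'), Lp.coeFn_smul a u'] with x h1 h2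
    simp only [h1, h2, Pi.add_apply, Pi.smul_apply, smul_sub]
    abel
  rw [eLpNorm_congr_ae heq]
  refine (eLpNorm_add_le (hf.sub (Lp.aestronglyMeasurable u))
    ((hf'.sub (Lp.aestronglyMeasurable u')).const_smul a) (by norm_num)).trans ?_
  rw [eLpNorm_const_smul, mul_add, mul_one, mul_comm δ]
  exact add_le_add h (mul_le_mul' le_rfl h')

lemma HasTraceWith.add_smul {u u' : L2 Ω} {g g' : L2Vec Ω} {φ φ' : L2Bdry Ω}
    (h : HasTraceWith Ω u g φ) (h' : HasTraceWith Ω u' g' φ') (a : ℝ) :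
    HasTraceWith Ω (u + a • u') (g + a • g') (φ + a • φ') := by
  refine ⟨h.1.add_smul h'.1 a, fun δ hδ => ?_⟩
  have hpos : 0 < δ / (1 + ‖a‖ₑ) := ENNReal.div_pos hδ.ne' (by finiteness)
  have hle : δ / (1 + ‖a‖ₑ) * (1 + ‖a‖ₑ) ≤ δ :=
    (ENNReal.div_mul_cancel (by positivity) (by finiteness)).le
  obtain ⟨f, hf, h1, h2, h3⟩ := h.2 _ hpos
  obtain ⟨f', hf', h1', h2', h3'⟩ := h'.2 _ hpos
  have hgrad : gradient (fun x => f x + a • f' x) = fun x => gradient f x + a • gradient f' x := by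
    funext x
    have hd := (hf.differentiable (by simp)) x
    have hd' := (hf'.differentiable (by simp)) x
    simp only [gradient]
    rw [fderiv_fun_add hd (hd'.fun_const_smul a), fderiv_fun_const_smul hd', map_add]
    simp
  refine ⟨fun x => f x + a • f' x, hf.add (hf'.const_smul a), ?_, ?_, ?_⟩
  · exact (eLpNorm_add_smul_sub_le hf.continuous.aestronglyMeasurable
      hf'.continuous.aestronglyMeasurable u u' a h1 h1').trans hle
  · rw [hgrad]
    exact (eLpNorm_add_smul_sub_le (continuous_gradient hf).aestronglyMeasurable
      (continuous_gradient hf').aestronglyMeasurable g g' a h2 h2').trans hle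
  · exact (eLpNorm_add_smul_sub_le hf.continuous.aestronglyMeasurable
      hf'.continuous.aestronglyMeasurable φ φ' a h3 h3').trans hle

lemma hasTraceWith_zero (Ω : Set (E n)) : HasTraceWith Ω 0 0 0 := by
  refine ⟨fun η hη hs _ i => ?_, fun δ hδ => ⟨fun _ => 0, contDiff_const, ?_, ?_, ?_⟩⟩
  · obtain ⟨A, B, hA, hB⟩ := exists_weakGradient_functionals Ω hη hs i
    rw [← hA, ← hB]
    simp
  · rw [eLpNorm_congr_ae (g := 0) (by
      filter_upwards [Lp.coeFn_zero ℝ 2 (volume.restrict Ω)] with x hx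
      simp only [hx, Pi.zero_apply, sub_zero])]
    simp
  · rw [eLpNorm_congr_ae (g := 0) (by
      filter_upwards [Lp.coeFn_zero (E n) 2 (volume.restrict Ω)] with x hx
      simp only [hx, Pi.zero_apply, sub_zero]
      simp [gradient])]
    simp
  · rw [eLpNorm_congr_ae (g := 0) (by
      filter_upwards [Lp.coeFn_zero ℝ 2 (surfaceMeasure Ω)] with x hx
      simp only [hx, Pi.zero_apply, sub_zero])]
    simp

lemma eLpNorm_sub_le_add_edist {α F : Type*} [MeasurableSpace α] [NormedAddCommGroup F]
    {ν : Measure α} {f : α → F} (hf : AEStronglyMeasurable f ν) (u u' : Lp F 2 ν) :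
    eLpNorm (fun x => f x - u x) 2 ν ≤ eLpNorm (fun x => f x - u' x) 2 ν + edist u' u := by
  rw [Lp.edist_def]
  refine le_trans (le_of_eq ?_) (eLpNorm_add_le (hf.sub (Lp.aestronglyMeasurable u'))
    ((Lp.aestronglyMeasurable u').sub (Lp.aestronglyMeasurable u)) (by norm_num))
  congr 1
  funext x
  simp

/-- The pairs `(w, ∇w)` for `w ∈ H¹₀(Ω)`. -/
def zeroTraceGraph (Ω : Set (E n)) : Submodule ℝ (WithLp 2 (L2 Ω × L2Vec Ω)) where
  carrier := {p | HasTraceWith Ω p.fst p.snd 0}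
  zero_mem' := hasTraceWith_zero Ω
  add_mem' := fun {p q} hp hq => by simpa using hp.add_smul hq 1
  smul_mem' := fun a p hp => by simpa using (hasTraceWith_zero Ω).add_smul hp a

lemma mem_zeroTraceGraph {p : WithLp 2 (L2 Ω × L2Vec Ω)} :
    p ∈ zeroTraceGraph Ω ↔ HasTraceWith Ω p.fst p.snd 0 := Iff.rfl

/-- A smooth function close to a nearby element `q` of the graph is close to `p` as well, and the
boundary error is unchanged because the trace is `0` for both. -/
lemma isClosed_zeroTraceGraph (Ω : Set (E n)) :
    IsClosed (zeroTraceGraph Ω : Set (WithLp 2 (L2 Ω × L2Vec Ω))) := by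
  refine isClosed_of_closure_subset fun p hp => ⟨?_, fun δ hδ => ?_⟩
  · refine closure_minimal (fun q hq => ?_) (isClosed_setOf_isWeakGradient Ω) hp
    exact (mem_zeroTraceGraph.1 hq).1
  · have hδ2 : 0 < δ / 2 := ENNReal.half_pos hδ.ne'
    obtain ⟨q, hq, hpq⟩ := EMetric.mem_closure_iff.1 hp (δ / 2) hδ2
    obtain ⟨f, hf, h1, h2, h3⟩ := hq.2 (δ / 2) hδ2
    have hfst : edist q.fst p.fst ≤ δ / 2 := by
      rw [edist_comm] at hpq
      exact (WithLp.edist_fst_le _ _).trans hpq.le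
    have hsnd : edist q.snd p.snd ≤ δ / 2 := by
      rw [edist_comm] at hpq
      exact (WithLp.edist_snd_le _ _).trans hpq.le
    refine ⟨f, hf, ?_, ?_, h3.trans ENNReal.half_le_self⟩
    · refine (eLpNorm_sub_le_add_edist hf.continuous.aestronglyMeasurable _ q.fst).trans ?_
      exact (add_le_add h1 hfst).trans_eq (ENNReal.add_halves δ)
    · refine (eLpNorm_sub_le_add_edist (continuous_gradient hf).aestronglyMeasurable _
        q.snd).trans ?_
      exact (add_le_add h2 hsnd).trans_eq (ENNReal.add_halves δ)

lemma exists_eLpNorm_le_boundary_add_gradient (hn : 1 ≤ n) (hΩ : IsOpen Ω)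
    (hb : Bornology.IsBounded Ω) :
    ∃ A : ℝ≥0, ∀ f : E n → ℝ, ContDiff ℝ ∞ f → eLpNorm f 2 (volume.restrict Ω) ≤
      A * (eLpNorm f 2 (surfaceMeasure Ω) + eLpNorm (gradient f) 2 (volume.restrict Ω)) := by
  obtain ⟨m, rfl⟩ : ∃ m, n = m + 1 := ⟨n - 1, by omega⟩
  obtain ⟨R, hR0, hR⟩ : ∃ R : ℝ≥0, 0 < R ∧ ∀ x ∈ Ω, ‖x‖ < R := by
    obtain ⟨R, hR0, hR⟩ := hb.exists_pos_norm_lt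
    exact ⟨⟨R, hR0.le⟩, hR0, hR⟩
  -- A generous constant: `(4(R+1)(s+g))²` minus the squared bound is a polynomial with nonnegative
  -- coefficients, written out in the `calc` below.
  refine ⟨4 * (R + 1), fun f hf => ?_⟩
  have h := lintegral_sq_le_boundary_add_gradient hΩ hR hf
  have hsq : ∀ {F : Type} [NormedAddCommGroup F] (ν : Measure (E (m + 1))) (f : E (m + 1) → F),
      ∫⁻ x, ‖f x‖ₑ ^ 2 ∂ν = eLpNorm f 2 ν ^ 2 := fun ν f => by
    simpa using (eLpNorm_nnreal_pow_eq_lintegral (p := 2) (by simp) (f := f) (μ := ν)).symm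
  rw [hsq, hsq, hsq, ENNReal.ofReal_coe_nnreal] at h
  refine (ENNReal.pow_le_pow_left_iff two_ne_zero).1 (h.trans ?_)
  set s := eLpNorm f 2 (surfaceMeasure Ω)
  set g := eLpNorm (gradient f) 2 (volume.restrict Ω)
  push_cast
  calc 2 * (R : ℝ≥0∞) * (2 * s ^ 2 + 4 * R * g ^ 2)
      = 4 * R * s ^ 2 + 8 * R ^ 2 * g ^ 2 := by ring
    _ ≤ 4 * R * s ^ 2 + 8 * R ^ 2 * g ^ 2 + (16 * R ^ 2 * s ^ 2 + 28 * R * s ^ 2 + 16 * s ^ 2 +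
        (8 * R ^ 2 * g ^ 2 + 32 * R * g ^ 2 + 16 * g ^ 2) + 32 * (R + 1) ^ 2 * s * g) :=
        le_self_add
    _ = (4 * (R + 1) * (s + g)) ^ 2 := by ring

/-- Poincaré's inequality in `H¹₀(Ω)`. -/
lemma exists_norm_le_gradient (hn : 1 ≤ n) (hΩ : IsOpen Ω) (hb : Bornology.IsBounded Ω) :
    ∃ C : ℝ, 0 ≤ C ∧ ∀ (u : L2 Ω) (g : L2Vec Ω), HasTraceWith Ω u g 0 → ‖u‖ ≤ C * ‖g‖ := by
  obtain ⟨A, hA⟩ := exists_eLpNorm_le_boundary_add_gradient hn hΩ hb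
  refine ⟨A, A.2, fun u g h => ?_⟩
  have key : eLpNorm u 2 (volume.restrict Ω) ≤ A * eLpNorm g 2 (volume.restrict Ω) := by
    refine ENNReal.le_of_forall_pos_le_add fun e he _ => ?_
    -- Approximating `u`, its gradient and its zero trace costs `δ + A(δ + δ)` in total, which is at
    -- most `e`.
    set δ : ℝ≥0∞ := e / (2 * A + 1)
    have hδ : 0 < δ := ENNReal.div_pos (by simpa using he.ne') (by finiteness)
    obtain ⟨f, hf, h1, h2, h3⟩ := h.2 δ hδ
    have hu : eLpNorm u 2 (volume.restrict Ω) ≤ δ + eLpNorm f 2 (volume.restrict Ω) := by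
      refine le_trans (le_of_eq ?_) ((eLpNorm_sub_le
        hf.continuous.aestronglyMeasurable
        (hf.continuous.aestronglyMeasurable.sub (Lp.aestronglyMeasurable u))
        (by norm_num)).trans ((add_le_add le_rfl h1).trans_eq (add_comm _ _)))
      congr 1
      funext x
      simp
    have hg : eLpNorm (gradient f) 2 (volume.restrict Ω) ≤
        δ + eLpNorm g 2 (volume.restrict Ω) := by
      refine le_trans (le_of_eq ?_) ((eLpNorm_add_le
        ((continuous_gradient hf).aestronglyMeasurable.sub (Lp.aestronglyMeasurable g))
        (Lp.aestronglyMeasurable g) (by norm_num)).trans (add_le_add h2 le_rfl))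
      congr 1
      funext x
      simp
    have hs : eLpNorm f 2 (surfaceMeasure Ω) ≤ δ := by
      refine le_trans (le_of_eq (eLpNorm_congr_ae ?_)) h3
      filter_upwards [Lp.coeFn_zero ℝ 2 (surfaceMeasure Ω)] with x hx
      simp only [hx, Pi.zero_apply, sub_zero]
    calc eLpNorm u 2 (volume.restrict Ω)
        ≤ δ + A * (δ + (δ + eLpNorm g 2 (volume.restrict Ω))) :=
          hu.trans (add_le_add le_rfl ((hA f hf).trans (mul_le_mul' le_rfl (add_le_add hs hg))))
      _ = A * eLpNorm g 2 (volume.restrict Ω) + δ * (2 * A + 1) := by ring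
      _ ≤ _ := add_le_add le_rfl
          (ENNReal.div_mul_cancel (by positivity) (by finiteness)).le
  rw [Lp.norm_def, Lp.norm_def]
  have := ENNReal.toReal_mono (by finiteness [Lp.eLpNorm_ne_top g]) key
  simpa using this

end Trace

/-! ### The linear Dirichlet problem -/

section Dirichlet

variable {n : ℕ} {Ω : Set (E n)}

lemma exists_mulL {c : E n → ℝ} (hc : AEStronglyMeasurable c (volume.restrict Ω)) {B : ℝ}
    (hB : ∀ᵐ x ∂(volume.restrict Ω), ‖c x‖ ≤ B) :
    ∃ m : L2 Ω →L[ℝ] L2 Ω, ∀ z : L2 Ω, m z =ᵐ[volume.restrict Ω] fun x => c x * z x := by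
  have hmem : MemLp c ⊤ (volume.restrict Ω) := memLp_top_of_bound hc B hB
  refine ⟨(ContinuousLinearMap.mul ℝ ℝ).holderL (volume.restrict Ω) ⊤ 2 2 (hmem.toLp c),
    fun z => ?_⟩
  have h := (ContinuousLinearMap.mul ℝ ℝ).coeFn_holder (r := 2) (hmem.toLp c) z
  filter_upwards [h, hmem.coeFn_toLp] with x h1 h2
  rw [← h2]
  exact h1

lemma inner_eq_integral_mul {c : E n → ℝ} {m : L2 Ω →L[ℝ] L2 Ω}
    (hm : ∀ z : L2 Ω, m z =ᵐ[volume.restrict Ω] fun x => c x * z x) (z ψ : L2 Ω) :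
    inner ℝ (m z) ψ = ∫ x in Ω, c x * z x * ψ x := by
  rw [L2.inner_def]
  refine integral_congr_ae ?_
  filter_upwards [hm z] with x hx
  simp [hx, mul_comm]

lemma inner_mul_self_nonneg {c : E n → ℝ} (hc : ∀ᵐ x ∂(volume.restrict Ω), 0 ≤ c x)
    {m : L2 Ω →L[ℝ] L2 Ω} (hm : ∀ z : L2 Ω, m z =ᵐ[volume.restrict Ω] fun x => c x * z x)
    (z : L2 Ω) : 0 ≤ inner ℝ (m z) z := by
  rw [inner_eq_integral_mul hm]
  refine integral_nonneg_of_ae ?_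
  filter_upwards [hc] with x hx
  rw [mul_assoc]
  exact mul_nonneg hx (mul_self_nonneg _)

/-- `z` with weak gradient `g` satisfies `-Δz + m z = 0` tested with `H¹₀(Ω)`, for a bounded
operator `m`. -/
def SolvesWith (Ω : Set (E n)) (m : L2 Ω →L[ℝ] L2 Ω) (z : L2 Ω) (g : L2Vec Ω) : Prop :=
  ∀ p ∈ zeroTraceGraph Ω, inner ℝ g p.snd + inner ℝ (m z) p.fst = 0

/-- By uniqueness of weak gradients, testing with all `ψ` and all their gradients is testing with
the elements of a Hilbert space, as Lax–Milgram requires. -/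
lemma isWeakSolution_iff (hΩ : IsOpen Ω) {c : E n → ℝ} {m : L2 Ω →L[ℝ] L2 Ω}
    (hm : ∀ z : L2 Ω, m z =ᵐ[volume.restrict Ω] fun x => c x * z x) {z : L2 Ω} :
    IsWeakSolution Ω c z ↔ ∃ g, IsWeakGradient Ω z g ∧ SolvesWith Ω m z g := by
  refine exists_congr fun g => and_congr_right fun _ => ⟨fun h p hp => ?_, fun h ψ hψ k hk => ?_⟩
  · rw [inner_eq_integral_mul hm, L2.inner_def]
    exact h p.fst ⟨⟨p.snd, hp.1⟩, hasTrace_iff.2 ⟨p.snd, hp⟩⟩ p.snd hp.1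
  · obtain ⟨k', hk'⟩ := hasTrace_iff.1 hψ.2
    obtain rfl := hk'.1.unique hΩ hk
    have := h (WithLp.toLp 2 (ψ, k')) hk'
    rwa [inner_eq_integral_mul hm, L2.inner_def] at this

lemma isWeakSolution_and_hasTrace_iff (hΩ : IsOpen Ω) {c : E n → ℝ} {m : L2 Ω →L[ℝ] L2 Ω}
    (hm : ∀ z : L2 Ω, m z =ᵐ[volume.restrict Ω] fun x => c x * z x) {z : L2 Ω} {φ : L2Bdry Ω} :
    IsWeakSolution Ω c z ∧ HasTrace Ω z φ ↔ ∃ g, HasTraceWith Ω z g φ ∧ SolvesWith Ω m z g := by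
  rw [isWeakSolution_iff hΩ hm, hasTrace_iff]
  refine ⟨fun ⟨⟨g, hg, hs⟩, k, hk⟩ => ?_, fun ⟨g, hg, hs⟩ => ⟨⟨g, hg.1, hs⟩, g, hg⟩⟩
  obtain rfl := hg.unique hΩ hk.1
  exact ⟨g, hk, hs⟩

/-- Stability: two solutions with the same trace differ by at most a multiple of the difference of
their potential terms. -/
lemma norm_sub_le_of_solvesWith {C : ℝ} (hC0 : 0 ≤ C)
    (hC : ∀ (u : L2 Ω) (g : L2Vec Ω), HasTraceWith Ω u g 0 → ‖u‖ ≤ C * ‖g‖)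
    {m₁ m₂ : L2 Ω →L[ℝ] L2 Ω} (hm : ∀ z, 0 ≤ inner ℝ (m₁ z) z)
    {v₁ v₂ : L2 Ω} {g₁ g₂ : L2Vec Ω} {φ : L2Bdry Ω}
    (ht₁ : HasTraceWith Ω v₁ g₁ φ) (hs₁ : SolvesWith Ω m₁ v₁ g₁)
    (ht₂ : HasTraceWith Ω v₂ g₂ φ) (hs₂ : SolvesWith Ω m₂ v₂ g₂) :
    ‖v₁ - v₂‖ ≤ C ^ 2 * ‖m₁ v₂ - m₂ v₂‖ := by
  have ht : HasTraceWith Ω (v₁ - v₂) (g₁ - g₂) 0 := by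
    simpa [sub_eq_add_neg] using ht₁.add_smul ht₂ (-1)
  have h1 : inner ℝ g₁ (g₁ - g₂) + inner ℝ (m₁ v₁) (v₁ - v₂) = 0 :=
    hs₁ (WithLp.toLp 2 (v₁ - v₂, g₁ - g₂)) ht
  have h2 : inner ℝ g₂ (g₁ - g₂) + inner ℝ (m₂ v₂) (v₁ - v₂) = 0 :=
    hs₂ (WithLp.toLp 2 (v₁ - v₂, g₁ - g₂)) ht
  set w := v₁ - v₂ with hw
  set g := g₁ - g₂ with hg
  have hP := hC w g ht
  -- This split isolates `⟨m₁ w, w⟩ ≥ 0`, which is dropped; what remains compares the two operators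
  -- on `v₂` alone.
  have hsplit : m₁ v₁ = m₁ w + m₁ v₂ := by rw [← map_add, hw, sub_add_cancel]
  have hsplit' : g₁ = g + g₂ := by rw [hg, sub_add_cancel]
  rw [hsplit, hsplit', inner_add_left, inner_add_left, real_inner_self_eq_norm_sq] at h1
  have hcs : -inner ℝ (m₁ v₂ - m₂ v₂) w ≤ ‖m₁ v₂ - m₂ v₂‖ * ‖w‖ := by
    rw [← inner_neg_left, ← norm_neg (m₁ v₂ - m₂ v₂)]
    exact real_inner_le_norm _ _
  rw [inner_sub_left] at hcs
  have hD := norm_nonneg (m₁ v₂ - m₂ v₂)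
  have hg2 : ‖g‖ ^ 2 ≤ (C * ‖m₁ v₂ - m₂ v₂‖) * ‖g‖ := by
    have := mul_le_mul_of_nonneg_left hP hD
    linarith [hm w]
  have hgle : ‖g‖ ≤ C * ‖m₁ v₂ - m₂ v₂‖ := by
    rcases (norm_nonneg g).eq_or_lt with h0 | h0
    · rw [← h0]; positivity
    · exact le_of_mul_le_mul_right (by rwa [sq] at hg2) h0
  calc ‖w‖ ≤ C * ‖g‖ := hP
    _ ≤ C * (C * ‖m₁ v₂ - m₂ v₂‖) := mul_le_mul_of_nonneg_left hgle hC0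
    _ = _ := by ring

lemma exists_solvesWith {C : ℝ}
    (hC : ∀ (u : L2 Ω) (g : L2Vec Ω), HasTraceWith Ω u g 0 → ‖u‖ ≤ C * ‖g‖)
    {m : L2 Ω →L[ℝ] L2 Ω} (hm : ∀ z, 0 ≤ inner ℝ (m z) z)
    {φ : L2Bdry Ω} (hφ : ∃ u, HasTrace Ω u φ) :
    ∃ v g, HasTraceWith Ω v g φ ∧ SolvesWith Ω m v g := by
  obtain ⟨u₀, hu₀⟩ := hφ
  obtain ⟨g₀, h₀⟩ := hasTrace_iff.1 hu₀
  have : CompleteSpace (zeroTraceGraph Ω) :=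
    (isClosed_zeroTraceGraph Ω).completeSpace_coe
  let P : zeroTraceGraph Ω →L[ℝ] L2 Ω :=
    (WithLp.fstL 2 ℝ (L2 Ω) (L2Vec Ω)) ∘L (zeroTraceGraph Ω).subtypeL
  let Q : zeroTraceGraph Ω →L[ℝ] L2Vec Ω :=
    (WithLp.sndL 2 ℝ (L2 Ω) (L2Vec Ω)) ∘L (zeroTraceGraph Ω).subtypeL
  let B : zeroTraceGraph Ω →L[ℝ] zeroTraceGraph Ω →L[ℝ] ℝ :=
    (innerSL ℝ).bilinearComp Q Q + (innerSL ℝ).bilinearComp (m ∘L P) P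
  have hB : ∀ p q, B p q = inner ℝ (Q p) (Q q) + inner ℝ (m (P p)) (P q) := fun p q => rfl
  have hcoer : IsCoercive B := by
    -- Poincaré bounds the graph norm: `‖p‖² ≤ (C² + 1) ‖Q p‖²`, and the potential term only helps.
    refine ⟨1 / (C ^ 2 + 1), by positivity, fun p => ?_⟩
    have h1 : ‖p‖ ^ 2 = ‖P p‖ ^ 2 + ‖Q p‖ ^ 2 := WithLp.prod_norm_sq_eq_of_L2 _
    have h2 : ‖P p‖ ≤ C * ‖Q p‖ := hC _ _ p.2
    have h3 : ‖P p‖ ^ 2 ≤ C ^ 2 * ‖Q p‖ ^ 2 := by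
      rw [← mul_pow]
      exact pow_le_pow_left₀ (norm_nonneg _) h2 2
    rw [hB, real_inner_self_eq_norm_sq, mul_assoc, ← sq, h1, one_div,
      inv_mul_le_iff₀ (by positivity)]
    have := mul_nonneg (by positivity : 0 ≤ C ^ 2 + 1) (hm (P p))
    linarith
  let ℓ : zeroTraceGraph Ω →L[ℝ] ℝ := -(innerSL ℝ g₀ ∘L Q) - (innerSL ℝ (m u₀) ∘L P)
  have hℓ : ∀ q, ℓ q = -inner ℝ g₀ (Q q) - inner ℝ (m u₀) (P q) := fun q => rfl
  let w := hcoer.continuousLinearEquivOfBilin.symm ((InnerProductSpace.toDual ℝ _).symm ℓ)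
  have hw : ∀ q, B w q = ℓ q := by
    intro q
    rw [← hcoer.continuousLinearEquivOfBilin_apply]
    simp [w]
  refine ⟨u₀ + P w, g₀ + Q w, ?_, fun p hp => ?_⟩
  · have := h₀.add_smul (mem_zeroTraceGraph.1 w.2) 1
    rwa [one_smul, one_smul, one_smul, add_zero] at this
  · have := hw ⟨p, hp⟩
    rw [hB, hℓ] at this
    rw [map_add, inner_add_left, inner_add_left]
    change inner ℝ (Q w) p.snd + inner ℝ (m (P w)) p.fst =
      -inner ℝ g₀ p.snd - inner ℝ (m u₀) p.fst at this
    linarith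

end Dirichlet

/-! ### The Picard map -/

section Picard

variable {n : ℕ} {Ω : Set (E n)}

/-- The potential of the `i`-th equation. -/
noncomputable def potential (ε : ℝ) (u : X Ω) (i : Fin 3) (x : E n) : ℝ := (u (i + 1) x * u (i + 2) x) ^ 2 / ε

lemma potential_nonneg {ε : ℝ} (hε : 0 < ε) (u : X Ω) (i : Fin 3) (x : E n) :
    0 ≤ potential ε u i x := by
  unfold potential
  positivity

lemma aestronglyMeasurable_potential (ε : ℝ) (u : X Ω) (i : Fin 3) :
    AEStronglyMeasurable (potential ε u i) (volume.restrict Ω) :=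
  ((((Lp.aestronglyMeasurable _).mul (Lp.aestronglyMeasurable _)).pow 2).aemeasurable.div_const
    ε).aestronglyMeasurable

lemma norm_potential_le {ε : ℝ} (hε : 0 < ε) {φ : Fin 3 → L2Bdry Ω} {u : X Ω} (hu : u ∈ K Ω φ)
    (i : Fin 3) : ∀ᵐ x ∂(volume.restrict Ω), ‖potential ε u i x‖ ≤ supBound Ω φ ^ 4 / ε := by
  filter_upwards [hu (i + 1), hu (i + 2)] with x h1 h2
  rw [Real.norm_of_nonneg (potential_nonneg hε u i x)]
  unfold potential
  have h3 : u (i + 1) x * u (i + 2) x ≤ supBound Ω φ ^ 2 := by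
    rw [sq]
    exact mul_le_mul h1.2 h2.2 h2.1 (h1.1.trans h1.2)
  have h4 := pow_le_pow_left₀ (mul_nonneg h1.1 h2.1) h3 2
  rw [← pow_mul] at h4
  exact div_le_div_of_nonneg_right h4 hε.le

/-- Dominated convergence with majorant `(2B)² z²`. Only convergence on each fixed `z` holds, not in
operator norm, and the stability estimate needs no more. -/
lemma tendsto_mul_of_ae_tendsto {c : ℕ → E n → ℝ} {c₀ : E n → ℝ}
    {m : ℕ → L2 Ω →L[ℝ] L2 Ω} {m₀ : L2 Ω →L[ℝ] L2 Ω}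
    (hm : ∀ k z, m k z =ᵐ[volume.restrict Ω] fun x => c k x * z x)
    (hm₀ : ∀ z, m₀ z =ᵐ[volume.restrict Ω] fun x => c₀ x * z x) {B : ℝ}
    (hB : ∀ k, ∀ᵐ x ∂(volume.restrict Ω), ‖c k x‖ ≤ B)
    (hB₀ : ∀ᵐ x ∂(volume.restrict Ω), ‖c₀ x‖ ≤ B)
    (hc : ∀ᵐ x ∂(volume.restrict Ω), Tendsto (fun k => c k x) atTop (𝓝 (c₀ x))) (z : L2 Ω) :
    Tendsto (fun k => m k z - m₀ z) atTop (𝓝 0) := by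
  rw [tendsto_zero_iff_norm_tendsto_zero]
  have hd : ∀ k, (m k z - m₀ z : L2 Ω) =ᵐ[volume.restrict Ω]
      fun x => (c k x - c₀ x) * z x := fun k => by
    filter_upwards [Lp.coeFn_sub (m k z) (m₀ z), hm k z, hm₀ z] with x h1 h2 h3
    rw [h1, Pi.sub_apply, h2, h3, sub_mul]
  have hnorm : ∀ k, ‖m k z - m₀ z‖ ^ 2 = ∫ x in Ω, ((c k x - c₀ x) * z x) ^ 2 := fun k => by
    rw [← real_inner_self_eq_norm_sq, L2.inner_def]
    refine integral_congr_ae ?_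
    filter_upwards [hd k] with x hx
    rw [hx, sq]
    rfl
  have hlim : Tendsto (fun k => ‖m k z - m₀ z‖ ^ 2) atTop (𝓝 0) := by
    simp only [hnorm]
    rw [← integral_zero (E n) ℝ (μ := volume.restrict Ω)]
    refine tendsto_integral_of_dominated_convergence (fun x => (2 * B) ^ 2 * z x ^ 2)
      (fun k => ?_) ((Lp.memLp z).integrable_sq.const_mul _) (fun k => ?_) ?_
    · exact ((Lp.aestronglyMeasurable _).congr (hd k)).pow 2
    · filter_upwards [hB k, hB₀] with x h1 h2
      rw [Real.norm_of_nonneg (sq_nonneg _), mul_pow]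
      refine mul_le_mul_of_nonneg_right ?_ (sq_nonneg _)
      rw [← sq_abs]
      refine pow_le_pow_left₀ (abs_nonneg _) ?_ 2
      rw [← Real.norm_eq_abs]
      exact (norm_sub_le _ _).trans (by linarith)
    · filter_upwards [hc] with x hx
      simpa using ((hx.sub_const (c₀ x)).mul_const (z x)).pow 2
  have := hlim.sqrt
  simpa using this

lemma exists_subseq_tendsto_ae {u : ℕ → L2 Ω} {u₀ : L2 Ω} (h : Tendsto u atTop (𝓝 u₀)) :
    ∃ ns : ℕ → ℕ, StrictMono ns ∧
      ∀ᵐ x ∂(volume.restrict Ω), Tendsto (fun k => u (ns k) x) atTop (𝓝 (u₀ x)) :=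
  (tendstoInMeasure_of_tendsto_Lp h).exists_seq_tendsto_ae

end Picard
end PartialSegregation

open PartialSegregation in
theorem lemma1p7 {n : ℕ} (hn : 1 ≤ n) (Ω : Set (E n)) (hΩ : IsLipschitzDomain Ω)
    (hΩb : Bornology.IsBounded Ω) (ε : ℝ) (hε : 0 < ε)
    (φ : Fin 3 → L2Bdry Ω) (hφ : ∀ i, φ i ∈ HHalf Ω)
    (hφb : ∀ i, eLpNorm (φ i) ⊤ (surfaceMeasure Ω) < ⊤)
    (hφ0 : ∀ i, ∀ᵐ x ∂(surfaceMeasure Ω), 0 ≤ φ i x) :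
    (∀ (u : K Ω φ) (v : X Ω), IsPicardImage Ω ε φ u v ↔ v = picardMap Ω ε φ u) ∧
      Continuous (picardMap Ω ε φ) := by
  obtain ⟨C, hC0, hC⟩ := exists_norm_le_gradient hn hΩ.isOpen hΩb
  choose m hm using fun (u : K Ω φ) (i : Fin 3) =>
    exists_mulL (aestronglyMeasurable_potential ε (u : X Ω) i) (norm_potential_le hε u.2 i)
  have hpos : ∀ u i z, 0 ≤ inner ℝ (m u i z) z := fun u i =>
    inner_mul_self_nonneg (Eventually.of_forall (potential_nonneg hε _ i)) (hm u i)
  have himage : ∀ (u : K Ω φ) (v : X Ω), IsPicardImage Ω ε φ u v ↔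
      ∀ i, ∃ g, HasTraceWith Ω (v i) g (φ i) ∧ SolvesWith Ω (m u i) (v i) g := fun u v =>
    forall_congr' fun i => isWeakSolution_and_hasTrace_iff hΩ.isOpen (hm u i)
  have hex : ∀ u : K Ω φ, ∃ v, IsPicardImage Ω ε φ u v := by
    intro u
    choose v g hv using fun i => exists_solvesWith hC (hpos u i) ((hφ i).imp fun _ h => h.2)
    exact ⟨v, (himage u v).2 fun i => ⟨g i, hv i⟩⟩
  have hpic : ∀ u : K Ω φ, IsPicardImage Ω ε φ u (picardMap Ω ε φ u) := fun u => by
    rw [picardMap, dif_pos (hex u)]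
    exact (hex u).choose_spec
  have hstab : ∀ (u u' : K Ω φ) (v v' : X Ω), IsPicardImage Ω ε φ u v →
      IsPicardImage Ω ε φ u' v' → ∀ i, ‖v i - v' i‖ ≤ C ^ 2 * ‖m u i (v' i) - m u' i (v' i)‖ := by
    intro u u' v v' h h' i
    obtain ⟨g, ht, hs⟩ := (himage u v).1 h i
    obtain ⟨g', ht', hs'⟩ := (himage u' v').1 h' i
    exact norm_sub_le_of_solvesWith hC0 hC (hpos u i) ht hs ht' hs'
  refine ⟨fun u v => ⟨fun h => funext fun i => ?_, fun h => h ▸ hpic u⟩, ?_⟩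
  · have := hstab u u v _ h (hpic u) i
    rw [sub_self, norm_zero, mul_zero] at this
    exact sub_eq_zero.1 (norm_le_zero_iff.1 this)
  · refine continuous_iff_seqContinuous.2 fun s u hs => tendsto_pi_nhds.2 fun i => ?_
    -- `L²` convergence gives a.e. convergence only along subsequences, so every subsequence is
    -- thinned twice, once for each factor of the potential.
    refine tendsto_of_subseq_tendsto fun ns hns => ?_
    have hcomp : ∀ j, Tendsto (fun k => (s (ns k) : X Ω) j) atTop (𝓝 ((u : X Ω) j)) := fun j =>
      (((continuous_apply j).comp continuous_subtype_val).tendsto u).comp (hs.comp hns)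
    obtain ⟨a, ha, hlim1⟩ := exists_subseq_tendsto_ae (hcomp (i + 1))
    obtain ⟨b, hb, hlim2⟩ := exists_subseq_tendsto_ae ((hcomp (i + 2)).comp ha.tendsto_atTop)
    refine ⟨a ∘ b, ?_⟩
    have hmlim := tendsto_mul_of_ae_tendsto (fun k => hm (s (ns (a (b k)))) i) (hm u i)
      (fun k => norm_potential_le hε (s (ns (a (b k)))).2 i) (norm_potential_le hε u.2 i)
      (by
        filter_upwards [hlim1, hlim2] with x h1 h2
        exact (((h1.comp hb.tendsto_atTop).mul h2).pow 2).div_const ε)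
      (picardMap Ω ε φ u i)
    rw [tendsto_iff_norm_sub_tendsto_zero]
    -- Stability is used with the limit solution in second place, so the varying operators act on a
    -- fixed function.
    refine squeeze_zero (fun _ => norm_nonneg _)
      (fun k => hstab _ u _ _ (hpic _) (hpic u) i) ?_
    simpa using hmlim.norm.const_mul (C ^ 2)
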